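/- Let $(E;\oplus,0,1)$ be an effect algebra: $0\neq 1$ and $\oplus$ is a partial binary operation on $E$ such that, for all $a,b,c\in E$, $b\oplus a=a\oplus b$ if $a\oplus b$ is defined; $(a\oplus b)\oplus c=a\oplus(b\oplus c)$ if one side is defined; there is a unique $a'\in E$ with $a\oplus a'=1$; and $a=0$ if $1\oplus a$ is defined. Order $E$ by $a\le b$ iff $a\oplus c=b$ for some $c\in E$; this $c$ is unique and is denoted $b\ominus a$. Suppose that - $E$ is a lattice effect algebra, i.e. $(E,\le)$ is a lattice (with least element $0$ and greatest element $1$); - $E$ is Archimedean, i.e. for every $x\neq 0$ there is an integer $n\ge 1$ such that $nx=x\oplus\dots\oplus x$ ($n$ times) is not defined; - $E$ is atomic, i.e. for every $x\ne 0$ there is an atom (a minimal nonzero element) $a\le x$; - $E$ is block-finite, i.e. it has only finitely many blocks, where a block is a maximal set of pairwise compatible elements, and $x,y$ are compatible if $x\vee y=x\oplus(y\ominus(x\wedge y))$. Let the interval topology $\tau_i$ on $E$ be the topology for which the intervals $[a,b]=\{x\in E\mid a\le x\le b\}$, $a\le b$, form a subbasis of closed sets. Say that a net $(x_\alpha)$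 in $E$ order converges to $x$ if there are nets $(u_\alpha)$ and $(v_\alpha)$ in $E$ over the same directed set, with $u_\alpha\le x_\alpha\le v_\alpha$ for all $\alpha$, such that $(u_\alpha)$ is increasing with $\bigvee_\alpha u_\alpha=x$ and $(v_\alpha)$ is decreasing with $\bigwedge_\alpha v_\alpha=x$. Let the order topology $\tau_o$ be the finest topology on $E$ in which every net that order converges to a point converges to that point. Then $\tau_i$ is Hausdorff and $\tau_i=\tau_o$. -/

import Mathlib

open Filter Topology

universe u

/-- An effect algebra. The partial operation `⊕` is `Option`-valued: `oplus a b = none` says that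
`a ⊕ b` is undefined. Equalities in `Option E` mean that one side is defined if and only if the
other one is, and that the values then agree. -/
class EffectAlgebra (E : Type u) extends Zero E, One E where
  oplus : E → E → Option E
  zero_ne_one : (0 : E) ≠ 1
  oplus_comm : ∀ a b : E, oplus a b = oplus b a
  oplus_assoc : ∀ a b c : E,
    ((oplus a b).bind fun s => oplus s c) = ((oplus b c).bind fun t => oplus a t)
  existsUnique_compl : ∀ a : E, ∃! b : E, oplus a b = some 1
  eq_zero_of_one_oplus : ∀ a : E, oplus 1 a ≠ none → a = 0

/-- A lattice effect algebra: the order induced by `⊕` is a lattice order. -/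
class LatticeEffectAlgebra (E : Type u) extends EffectAlgebra E, Lattice E where
  le_iff_exists_oplus : ∀ a b : E, a ≤ b ↔ ∃ c : E, oplus a c = some b

namespace EffectAlgebra

/-- The multiple `nx = x ⊕ ⋯ ⊕ x` (`n` times), `none` if it does not exist. -/
def multiple {E : Type u} [EffectAlgebra E] (x : E) : ℕ → Option E
  | 0 => some 0
  | n + 1 => (multiple x n).bind fun s => oplus s x

/-- `ord x = ∞`: all the multiples `nx`, `n ≥ 1`, exist. -/
def HasInfiniteOrder {E : Type u} [EffectAlgebra E] (x : E) : Prop :=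
  ∀ n : ℕ, 0 < n → multiple x n ≠ none

/-- `E` is Archimedean if every nonzero element has finite order
(the zero element always has infinite order). -/
def IsArchimedean (E : Type u) [EffectAlgebra E] : Prop :=
  ∀ x : E, x ≠ 0 → ¬ HasInfiniteOrder x

theorem oplus_zero {E : Type u} [EffectAlgebra E] (a : E) : oplus a 0 = some a := by
  have h1 : oplus (1 : E) 0 = some 1 := by
    obtain ⟨b, hb, -⟩ := existsUnique_compl (1 : E)
    have h0 : b = 0 := eq_zero_of_one_oplus b (by simp [hb])
    rwa [h0] at hb
  obtain ⟨b, hb, -⟩ := existsUnique_compl a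
  have hba : oplus b a = some 1 := by rw [oplus_comm]; exact hb
  have h := oplus_assoc b a 0
  rw [hba, Option.bind_some, h1] at h
  obtain ⟨t, ht, ht1⟩ := Option.bind_eq_some_iff.1 h.symm
  obtain ⟨c, -, hc⟩ := existsUnique_compl b
  rw [ht, hc t ht1, hc a hba]

end EffectAlgebra

namespace LatticeEffectAlgebra

open EffectAlgebra

/-- The elements `0` and `1` are the bounds of the lattice. -/
instance (E : Type u) [LatticeEffectAlgebra E] : BoundedOrder E where
  bot := 0
  top := 1
  bot_le a := (le_iff_exists_oplus 0 a).2 ⟨a, by rw [oplus_comm, oplus_zero]⟩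
  le_top a := (le_iff_exists_oplus a 1).2 (existsUnique_compl a).exists

/-- `x` and `y` are compatible: `x ⊔ y = x ⊕ (y ⊖ (x ⊓ y))`. Here `d` is the
difference `y ⊖ (x ⊓ y)`, the element with `(x ⊓ y) ⊕ d = y`. -/
def Compatible {E : Type u} [LatticeEffectAlgebra E] (x y : E) : Prop :=
  ∃ d : E, oplus (x ⊓ y) d = some y ∧ oplus x d = some (x ⊔ y)

/-- A block is a maximal set of pairwise compatible elements. -/
def IsBlock {E : Type u} [LatticeEffectAlgebra E] (M : Set E) : Prop :=
  Maximal (fun S : Set E => ∀ x ∈ S, ∀ y ∈ S, Compatible x y) M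

/-- `E` has only finitely many blocks. -/
def IsBlockFinite (E : Type u) [LatticeEffectAlgebra E] : Prop :=
  {M : Set E | IsBlock M}.Finite

end LatticeEffectAlgebra

/-- The interval topology `τ_i`: the closed intervals `[a, b]`, `a ≤ b`, are a subbasis of
closed sets. -/
abbrev intervalTopology (L : Type u) [Preorder L] : TopologicalSpace L :=
  TopologicalSpace.generateFrom {U : Set L | ∃ a b : L, a ≤ b ∧ U = (Set.Icc a b)ᶜ}

/-- Order convergence of a net: there are `u α ≤ x α ≤ v α` with `u` increasing to `l` and
`v` decreasing to `l`. -/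
def OrderConverges {L : Type u} [Preorder L] {ι : Type u} [Preorder ι] (x : ι → L) (l : L) :
    Prop :=
  ∃ u v : ι → L, Monotone u ∧ IsLUB (Set.range u) l ∧ Antitone v ∧ IsGLB (Set.range v) l ∧
    ∀ α : ι, u α ≤ x α ∧ x α ≤ v α

/-- Every order convergent net converges to the same point in the topology `t`. -/
def OrderConvergenceImplies (L : Type u) [Preorder L] (t : TopologicalSpace L) : Prop :=
  ∀ (ι : Type u) [Preorder ι] [IsDirectedOrder ι] [Nonempty ι] (x : ι → L) (l : L),
    OrderConverges x l → Tendsto x atTop (@nhds L t l)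

/-- The order topology `τ_o`: the finest topology in which every order convergent net converges
to its order limit. (In the order on topologies used here, finer means smaller;
see `isLeast_netOrderTopology`.) -/
abbrev netOrderTopology (L : Type u) [Preorder L] : TopologicalSpace L :=
  sInf {t : TopologicalSpace L | OrderConvergenceImplies L t}

theorem isLeast_netOrderTopology (L : Type u) [Preorder L] :
    IsLeast {t : TopologicalSpace L | OrderConvergenceImplies L t} (netOrderTopology L) := by
  refine ⟨?_, fun t ht => sInf_le ht⟩
  intro ι _ _ _ x l hx
  rw [netOrderTopology, nhds_sInf]
  simp only [tendsto_iInf]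
  intro t ht
  exact ht ι x l hx

/-! The two claims are separated. On any bounded lattice, a Hausdorff interval topology coincides
with the order topology (`intervalTopology_eq_netOrderTopology`): if an ultrafilter `F` converges to
`c` for `τ_i`, then so it does to `c ⊓ d` for every upper bound `d` of `{a | [a, 1] ∈ F}`; hence `c`
is the supremum of this set, dually for infima, and a net describing `F` order converges to `c`.

For the Hausdorff property, two points `x ≠ y` are separated as soon as `E` is a finite union of
intervals none of which contains both. Since `E` is the union of its finitely many blocks, each
block `M` may be covered separately, by an interval `[c, 1]` and an interval `[0, d]`
(`IsBlock.exists_cover`).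

The key is that, by block-finiteness, `M` is the commutant of a finite set `D ⊆ M`, which contains
one element of `M \ N` for each other block `N`. Splitting along the elements of `D`, every element
of `M` is a finite orthogonal sum of elements `c ∈ M` with `[0, c] ⊆ M` (`IsBlock.induction`).
Therefore `M` contains an atom of `E` below each of its nonzero elements, and an element of `E`
compatible with all atoms in `M` lies in `M`, because each `c` as above is the supremum in `E` of
multiples of atoms in `M`. Now let `x ≠ y`.

* If `x ∉ M`, there is an atom `b ∈ M` not compatible with `x`. Every `z ∈ M` satisfies `b ≤ z` or
  `z ≤ b'`, whereas `x` satisfies neither.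
* If `x, y ∈ M` and `x ≰ y`, there is an atom `b ∈ M` with `kb ≤ x` and `kb ≰ y` for some `k`. If `n`
  is the order of `b`, every `z ∈ M` satisfies `kb ≤ z` or `z ≤ ((n + 1 - k)b)'`; here `y` fails the
  first condition and `x` the second.
-/

/-! ### Order topology and Hausdorff interval topologies -/

theorem isOpen_compl_Icc_intervalTopology {L : Type u} [Preorder L] {a b : L} (h : a ≤ b) :
    IsOpen[intervalTopology L] (Set.Icc a b)ᶜ :=
  TopologicalSpace.isOpen_generateFrom_of_mem ⟨a, b, h, rfl⟩

theorem orderConvergenceImplies_intervalTopology (L : Type u) [Preorder L] :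
    OrderConvergenceImplies L (intervalTopology L) := by
  intro ι _ _ _ x l ⟨u, v, hu, hul, hv, hvl, hx⟩
  rw [TopologicalSpace.tendsto_nhds_generateFrom_iff]
  rintro _ ⟨a, b, -, rfl⟩ hl
  by_cases ha : a ≤ l
  · have hb : ¬ l ≤ b := fun hb => hl ⟨ha, hb⟩
    have : ∃ α, ¬ u α ≤ b := by
      by_contra! h
      exact hb (hul.2 (by rintro _ ⟨α, rfl⟩; exact h α))
    obtain ⟨α, hα⟩ := this
    filter_upwards [eventually_ge_atTop α] with β hβ
    exact fun h => hα ((hu hβ).trans ((hx β).1.trans h.2))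
  · have : ∃ α, ¬ a ≤ v α := by
      by_contra! h
      exact ha (hvl.2 (by rintro _ ⟨α, rfl⟩; exact h α))
    obtain ⟨α, hα⟩ := this
    filter_upwards [eventually_ge_atTop α] with β hβ
    exact fun h => hα (h.1.trans ((hx β).2.trans (hv hβ)))

/-- An ultrafilter `F` converges to `c` in the interval topology if and only if `c` lies above every
`a` with `[a, ⊤] ∈ F` and below every `b` with `[⊥, b] ∈ F`. -/
theorem ultrafilter_le_nhds_intervalTopology_iff {L : Type u} [Lattice L] [BoundedOrder L]
    (F : Ultrafilter L) (c : L) :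
    (F : Filter L) ≤ @nhds L (intervalTopology L) c ↔
      (∀ a, Set.Ici a ∈ F → a ≤ c) ∧ ∀ b, Set.Iic b ∈ F → c ≤ b := by
  let _ := intervalTopology L
  constructor
  · intro h
    have key : ∀ a b : L, Set.Icc a b ∈ F → a ≤ b → c ∈ Set.Icc a b := by
      intro a b hF hab
      by_contra hc
      have := h ((isOpen_compl_Icc_intervalTopology hab).mem_nhds hc)
      exact Ultrafilter.compl_notMem_iff.2 hF this
    constructor
    · intro a ha
      exact (key a ⊤ (by rwa [Set.Icc_top]) le_top).1
    · intro b hb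
      exact (key ⊥ b (by rwa [Set.Icc_bot]) bot_le).2
  · rintro ⟨h1, h2⟩
    have : Tendsto id (F : Filter L) (𝓝 c) := by
      rw [TopologicalSpace.tendsto_nhds_generateFrom_iff]
      rintro _ ⟨a, b, -, rfl⟩ hc
      by_contra hF
      have hF' : Set.Icc a b ∈ F := by
        have := Ultrafilter.compl_mem_iff_notMem.2 hF
        rwa [Set.preimage_id, compl_compl] at this
      exact hc ⟨h1 a (mem_of_superset hF' fun z hz => hz.1),
        h2 b (mem_of_superset hF' fun z hz => hz.2)⟩
    exact this

/-- The index set of a net describing an ultrafilter `F`: its elements are the points of the sets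
`[lower, upper] ∩ set` in `F`, together with `lower`, `upper` and `set`. -/
structure IntervalNetIndex {L : Type u} [Preorder L] (F : Ultrafilter L) where
  lower : L
  upper : L
  set : Set L
  point : L
  Ici_mem : Set.Ici lower ∈ F
  Iic_mem : Set.Iic upper ∈ F
  set_mem : set ∈ F
  point_mem : point ∈ set
  lower_le : lower ≤ point
  le_upper : point ≤ upper

namespace IntervalNetIndex

/-- Indices are ordered by shrinking intervals and sets, whatever their points are. -/
instance {L : Type u} [Preorder L] (F : Ultrafilter L) : Preorder (IntervalNetIndex F) where
  le q r := q.lower ≤ r.lower ∧ r.upper ≤ q.upper ∧ r.set ⊆ q.set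
  le_refl q := ⟨le_rfl, le_rfl, Set.Subset.rfl⟩
  le_trans _ _ _ h h' := ⟨h.1.trans h'.1, h'.2.1.trans h.2.1, h'.2.2.trans h.2.2⟩

theorem exists_index {L : Type u} [Preorder L] {F : Ultrafilter L} {a b : L} {S : Set L}
    (ha : Set.Ici a ∈ F) (hb : Set.Iic b ∈ F) (hS : S ∈ F) :
    ∃ q : IntervalNetIndex F, q.lower = a ∧ q.upper = b ∧ q.set = S := by
  obtain ⟨z, ⟨hz1, hz2⟩, hz3⟩ :=
    Ultrafilter.nonempty_of_mem (inter_mem (inter_mem ha hb) hS)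
  exact ⟨⟨a, b, S, z, ha, hb, hS, hz3, hz1, hz2⟩, rfl, rfl, rfl⟩

instance {L : Type u} [Lattice L] (F : Ultrafilter L) : IsDirectedOrder (IntervalNetIndex F) where
  directed q r := by
    obtain ⟨s, h1, h2, h3⟩ := exists_index (F := F)
      (a := q.lower ⊔ r.lower) (b := q.upper ⊓ r.upper) (S := q.set ∩ r.set)
      (by rw [← Set.Ici_inter_Ici]; exact inter_mem q.Ici_mem r.Ici_mem)
      (by rw [← Set.Iic_inter_Iic]; exact inter_mem q.Iic_mem r.Iic_mem)
      (inter_mem q.set_mem r.set_mem)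
    exact ⟨s, ⟨le_sup_left.trans h1.ge, h2.le.trans inf_le_left, h3.le.trans inf_le_left⟩,
      ⟨le_sup_right.trans h1.ge, h2.le.trans inf_le_right, h3.le.trans inf_le_right⟩⟩

end IntervalNetIndex

theorem intervalTopology_eq_netOrderTopology (L : Type u) [Lattice L] [BoundedOrder L]
    (hT2 : @T2Space L (intervalTopology L)) : intervalTopology L = netOrderTopology L := by
  refine le_antisymm ?_ (sInf_le (orderConvergenceImplies_intervalTopology L))
  refine le_of_nhds_le_nhds fun c => ?_
  rw [le_iff_ultrafilter]
  intro F hF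
  obtain ⟨hA, hB⟩ := (ultrafilter_le_nhds_intervalTopology_iff F c).1 hF
  have hAlub : IsLUB {a | Set.Ici a ∈ F} c := by
    refine ⟨fun a ha => hA a ha, fun d hd => ?_⟩
    have h := (ultrafilter_le_nhds_intervalTopology_iff F (c ⊓ d)).2
      ⟨fun a ha => le_inf (hA a ha) (hd ha), fun b hb => inf_le_left.trans (hB b hb)⟩
    have := @tendsto_nhds_unique L L (intervalTopology L) hT2 id F _ _ _ h hF
    exact inf_eq_left.1 this
  have hBglb : IsGLB {b | Set.Iic b ∈ F} c := by
    refine ⟨fun b hb => hB b hb, fun d hd => ?_⟩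
    have h := (ultrafilter_le_nhds_intervalTopology_iff F (c ⊔ d)).2
      ⟨fun a ha => (hA a ha).trans le_sup_left, fun b hb => sup_le (hB b hb) (hd hb)⟩
    have := @tendsto_nhds_unique L L (intervalTopology L) hT2 id F _ _ _ h hF
    exact sup_eq_left.1 this
  have huniv : (Set.univ : Set L) ∈ F := univ_mem
  have hbot : Set.Ici (⊥ : L) ∈ F := by rwa [Set.Ici_bot]
  have htop : Set.Iic (⊤ : L) ∈ F := by rwa [Set.Iic_top]
  have hne : Nonempty (IntervalNetIndex F) :=
    let ⟨q, _⟩ := IntervalNetIndex.exists_index hbot htop huniv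
    ⟨q⟩
  have hconv : OrderConverges (IntervalNetIndex.point (F := F)) c := by
    refine ⟨IntervalNetIndex.lower, IntervalNetIndex.upper, fun q r h => h.1, ?_,
      fun q r h => h.2.1, ?_, fun q => ⟨q.lower_le, q.le_upper⟩⟩
    · convert hAlub
      ext a
      constructor
      · rintro ⟨q, rfl⟩
        exact q.Ici_mem
      · intro ha
        obtain ⟨q, h, -⟩ := IntervalNetIndex.exists_index ha htop huniv
        exact ⟨q, h⟩
    · convert hBglb
      ext b
      constructor
      · rintro ⟨q, rfl⟩
        exact q.Iic_mem
      · intro hb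
        obtain ⟨q, -, h, -⟩ := IntervalNetIndex.exists_index hbot hb huniv
        exact ⟨q, h⟩
  have hlim := (isLeast_netOrderTopology L).1 _ _ c hconv
  intro U hU
  obtain ⟨q, hq⟩ := mem_atTop_sets.1 (hlim hU)
  refine mem_of_superset (inter_mem (inter_mem q.Ici_mem q.Iic_mem) q.set_mem) ?_
  rintro z ⟨⟨hz1, hz2⟩, hz3⟩
  -- The point of `q` may be replaced by any `z` without leaving the tail above `q`.
  exact hq { q with point := z, point_mem := hz3, lower_le := hz1, le_upper := hz2 }
    ⟨le_rfl, le_rfl, Set.Subset.rfl⟩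

/-- If for any `x ≠ y` finitely many intervals `[c, ⊤]` and `[⊥, d]`, none of which contains both
`x` and `y`, cover `L`, then the interval topology is Hausdorff. -/
theorem t2Space_intervalTopology_of_finite_cover {L : Type u} [Lattice L] [BoundedOrder L]
    (h : ∀ x y : L, x ≠ y → ∃ T : Set (L × L), T.Finite ∧ (∀ z, ∃ p ∈ T, p.1 ≤ z ∨ z ≤ p.2) ∧
      ∀ p ∈ T, ¬ (p.1 ≤ x ∧ p.1 ≤ y) ∧ ¬ (x ≤ p.2 ∧ y ≤ p.2)) :
    @T2Space L (intervalTopology L) := by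
  let _ := intervalTopology L
  refine ⟨fun x y hxy => ?_⟩
  obtain ⟨T, hT, hcov, hsep⟩ := h x y hxy
  let S : Set (Set L) := (fun p : L × L => Set.Icc p.1 ⊤) '' T ∪ (fun p => Set.Icc ⊥ p.2) '' T
  have hS : S.Finite := (hT.image _).union (hT.image _)
  have hopen : ∀ I ∈ S, IsOpen Iᶜ := by
    rintro I (⟨p, -, rfl⟩ | ⟨p, -, rfl⟩)
    · exact isOpen_compl_Icc_intervalTopology le_top
    · exact isOpen_compl_Icc_intervalTopology bot_le
  have hnot : ∀ I ∈ S, ¬ (x ∈ I ∧ y ∈ I) := by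
    rintro I (⟨p, hp, rfl⟩ | ⟨p, hp, rfl⟩) ⟨h1, h2⟩
    · exact (hsep p hp).1 ⟨h1.1, h2.1⟩
    · exact (hsep p hp).2 ⟨h1.2, h2.2⟩
  have hopen' : ∀ w : L, IsOpen (⋂ I ∈ {I ∈ S | w ∉ I}, Iᶜ) := fun w =>
    (hS.subset fun I hI => hI.1).isOpen_biInter fun I hI => hopen I hI.1
  refine ⟨_, _, hopen' x, hopen' y, ?_, ?_, ?_⟩
  · exact Set.mem_iInter₂.2 fun I hI => hI.2
  · exact Set.mem_iInter₂.2 fun I hI => hI.2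
  · rw [Set.disjoint_left]
    intro z hzx hzy
    rw [Set.mem_iInter₂] at hzx hzy
    obtain ⟨I, hI, hzI⟩ : ∃ I ∈ S, z ∈ I := by
      obtain ⟨p, hp, hz | hz⟩ := hcov z
      · exact ⟨_, Or.inl ⟨p, hp, rfl⟩, hz, le_top⟩
      · exact ⟨_, Or.inr ⟨p, hp, rfl⟩, bot_le, hz⟩
    by_cases hx : x ∈ I
    · exact hzy I ⟨hI, fun hy => hnot I hI ⟨hx, hy⟩⟩ hzI
    · exact hzx I ⟨hI, hx⟩ hzI

/-! ### Partial addition in effect algebras -/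

namespace EffectAlgebra

variable {E : Type u} [EffectAlgebra E] {a b c d s t : E}

theorem zero_oplus (a : E) : oplus 0 a = some a := by rw [oplus_comm, oplus_zero]

theorem exists_oplus_assoc (h : oplus a b = some s) (h' : oplus s c = some t) :
    ∃ u, oplus b c = some u ∧ oplus a u = some t := by
  have := oplus_assoc a b c
  rw [h, Option.bind_some, h'] at this
  exact Option.bind_eq_some_iff.1 this.symm

theorem exists_oplus_assoc' (h : oplus b c = some s) (h' : oplus a s = some t) :
    ∃ u, oplus a b = some u ∧ oplus u c = some t := by
  have := oplus_assoc a b c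
  rw [h, Option.bind_some, h'] at this
  exact Option.bind_eq_some_iff.1 this

theorem exists_oplus_right_comm (h : oplus a b = some s) (h' : oplus s c = some t) :
    ∃ u, oplus a c = some u ∧ oplus u b = some t := by
  obtain ⟨u, hu, hu'⟩ := exists_oplus_assoc h h'
  rw [oplus_comm] at hu
  exact exists_oplus_assoc' hu hu'

theorem oplus_right_comm (h : oplus a b = some s) (h' : oplus s c = some t)
    (h'' : oplus a c = some d) : oplus d b = some t := by
  obtain ⟨u, hu, hu'⟩ := exists_oplus_right_comm h h'
  rwa [Option.some.inj (h''.symm.trans hu)]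

theorem oplus_left_cancel (h : oplus a b = some s) (h' : oplus a c = some s) : b = c := by
  obtain ⟨e, he, -⟩ := existsUnique_compl s
  rw [oplus_comm] at h h'
  obtain ⟨u, hu, hu'⟩ := exists_oplus_assoc h he
  obtain ⟨v, hv, hv'⟩ := exists_oplus_assoc h' he
  obtain rfl := Option.some.inj (hu.symm.trans hv)
  rw [oplus_comm] at hu' hv'
  exact (existsUnique_compl u).unique hu' hv'

/-- The orthosupplement `a'`, the element with `a ⊕ a' = 1`. -/
noncomputable def compl (a : E) : E := (existsUnique_compl a).choose

theorem oplus_compl (a : E) : oplus a (compl a) = some 1 :=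
  (existsUnique_compl a).choose_spec.1

theorem eq_compl (h : oplus a b = some 1) : b = compl a :=
  oplus_left_cancel h (oplus_compl a)

theorem compl_compl_eq (a : E) : compl (compl a) = a :=
  (eq_compl (by rw [oplus_comm, oplus_compl])).symm

theorem multiple_add (a : E) (m n : ℕ) :
    multiple a (m + n) = (multiple a m).bind fun s => (multiple a n).bind fun t => oplus s t := by
  induction n with
  | zero => simp [multiple, oplus_zero]
  | succ n ih =>
    rw [← add_assoc, multiple, ih, multiple]
    cases multiple a m with
    | none => rfl
    | some s =>
      cases multiple a n with
      | none => rfl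
      | some t => simpa using oplus_assoc s t a

theorem multiple_add_eq_some {m n : ℕ} (hm : multiple a m = some s) (hn : multiple a n = some t) :
    multiple a (m + n) = oplus s t := by
  rw [multiple_add, hm, hn]; rfl

theorem exists_multiple_of_add {m n : ℕ} (h : multiple a (m + n) = some c) :
    ∃ s t, multiple a m = some s ∧ multiple a n = some t ∧ oplus s t = some c := by
  rw [multiple_add] at h
  obtain ⟨s, hs, h⟩ := Option.bind_eq_some_iff.1 h
  obtain ⟨t, ht, h⟩ := Option.bind_eq_some_iff.1 h
  exact ⟨s, t, hs, ht, h⟩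

end EffectAlgebra

namespace LatticeEffectAlgebra

open EffectAlgebra

variable {E : Type u} [LatticeEffectAlgebra E] {a b c d g p q s t u v w x y z : E}

theorem left_le_of_oplus (h : oplus a b = some c) : a ≤ c := (le_iff_exists_oplus a c).2 ⟨b, h⟩

theorem right_le_of_oplus (h : oplus a b = some c) : b ≤ c :=
  left_le_of_oplus (by rwa [oplus_comm] at h)

theorem exists_oplus_of_le_left (h : oplus a b = some c) (had : d ≤ a) :
    ∃ e, oplus d b = some e ∧ e ≤ c := by
  obtain ⟨f, hf⟩ := (le_iff_exists_oplus d a).1 had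
  obtain ⟨e, he, he'⟩ := exists_oplus_right_comm hf h
  exact ⟨e, he, left_le_of_oplus he'⟩

theorem exists_oplus_of_le_right (h : oplus a b = some c) (hbd : d ≤ b) :
    ∃ e, oplus a d = some e ∧ e ≤ c := by
  rw [oplus_comm] at h
  obtain ⟨e, he, he'⟩ := exists_oplus_of_le_left h hbd
  exact ⟨e, by rwa [oplus_comm] at he, he'⟩

/-- Subtraction is monotone in the minuend and antitone in the subtrahend. -/
theorem right_le_right_of_oplus (h : oplus a b = some c) (h' : oplus p q = some d) (hcd : c ≤ d)
    (hpa : p ≤ a) : b ≤ q := by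
  obtain ⟨e, he, hec⟩ := exists_oplus_of_le_left h hpa
  obtain ⟨f, hf⟩ := (le_iff_exists_oplus e d).1 (hec.trans hcd)
  obtain ⟨k, hk, hk'⟩ := exists_oplus_assoc he hf
  obtain rfl := oplus_left_cancel h' hk'
  exact left_le_of_oplus hk

theorem left_le_left_of_oplus (h : oplus a b = some c) (h' : oplus p q = some d) (hcd : c ≤ d)
    (hqb : q ≤ b) : a ≤ p := by
  rw [oplus_comm] at h h'
  exact right_le_right_of_oplus h h' hcd hqb

theorem compl_le_compl (h : a ≤ b) : compl b ≤ compl a :=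
  right_le_right_of_oplus (oplus_compl b) (oplus_compl a) le_rfl h

theorem compl_le_compl_iff : compl b ≤ compl a ↔ a ≤ b :=
  ⟨fun h => by simpa only [compl_compl_eq] using compl_le_compl h, compl_le_compl⟩

theorem le_compl_comm : a ≤ compl b ↔ b ≤ compl a := by
  rw [← compl_le_compl_iff, compl_compl_eq]

theorem le_compl_of_oplus (h : oplus a b = some c) : b ≤ compl a :=
  right_le_right_of_oplus h (oplus_compl a) le_top le_rfl

theorem exists_oplus_of_le_compl (h : b ≤ compl a) : ∃ c, oplus a b = some c :=
  (exists_oplus_of_le_right (oplus_compl a) h).imp fun _ h => h.1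

theorem compl_inf (a b : E) : compl (a ⊓ b) = compl a ⊔ compl b := by
  refine le_antisymm ?_ (sup_le (compl_le_compl inf_le_left) (compl_le_compl inf_le_right))
  rw [← compl_le_compl_iff, compl_compl_eq]
  refine le_inf ?_ ?_
  · rw [← compl_le_compl_iff, compl_compl_eq]; exact le_sup_left
  · rw [← compl_le_compl_iff, compl_compl_eq]; exact le_sup_right

/-! ### Compatibility -/

/-- Mackey compatibility: if `u ⊕ p ⊕ q` is defined then `u ⊕ p` and `u ⊕ q` are compatible. -/
theorem compatible_of_oplus (hx : oplus u p = some x) (hy : oplus u q = some y)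
    (hv : oplus x q = some v) : Compatible x y := by
  have hv' : oplus y p = some v := oplus_right_comm hx hv hy
  have hsup : x ⊔ y ≤ v := sup_le (left_le_of_oplus hv) (left_le_of_oplus hv')
  obtain ⟨s, hs⟩ := (le_iff_exists_oplus x (x ⊔ y)).1 le_sup_left
  obtain ⟨t, ht⟩ := (le_iff_exists_oplus (x ⊓ y) y).1 inf_le_right
  -- With `q = s ⊕ r`, the element `u ⊕ r = y ⊖ s` lies below `x` and `y`; so `y ⊖ (x ⊓ y) ≤ s`.
  have hts : t ≤ s := by
    obtain ⟨r, hr⟩ := (le_iff_exists_oplus s q).1 (right_le_right_of_oplus hs hv hsup le_rfl)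
    rw [oplus_comm] at hr
    obtain ⟨m, hm, hm'⟩ := exists_oplus_assoc' hr hy
    have hmx : m ≤ x := left_le_left_of_oplus hm' hs le_sup_right le_rfl
    exact right_le_right_of_oplus ht hm' le_rfl (le_inf hmx (left_le_of_oplus hm'))
  obtain ⟨e, he, hes⟩ := exists_oplus_of_le_right hs hts
  -- Dually, `x ⊕ t` lies above `y`.
  have hye : y ≤ e := by
    obtain ⟨f, hf⟩ := (le_iff_exists_oplus u (x ⊓ y)).1
      (le_inf (left_le_of_oplus hx) (left_le_of_oplus hy))
    obtain ⟨m, hm, hm'⟩ := exists_oplus_assoc hf ht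
    obtain rfl := oplus_left_cancel hy hm'
    rw [oplus_comm] at hm
    obtain ⟨e', he1, he2⟩ := exists_oplus_assoc' hm hv
    obtain rfl := Option.some.inj (he.symm.trans he1)
    exact left_le_left_of_oplus hv' he2 le_rfl
      (right_le_right_of_oplus hf hx inf_le_left le_rfl)
  obtain rfl := le_antisymm hes (sup_le (left_le_of_oplus he) hye)
  exact ⟨t, ht, he⟩

theorem compatible_of_le_oplus (h : oplus x p = some v) (hp : p ≤ y) (hy : y ≤ v) :
    Compatible x y := by
  obtain ⟨s, hs⟩ := (le_iff_exists_oplus x (x ⊔ y)).1 le_sup_left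
  have hsp : s ≤ p :=
    right_le_right_of_oplus hs h (sup_le (left_le_of_oplus h) hy) le_rfl
  obtain ⟨u, hu⟩ := (le_iff_exists_oplus s y).1 (hsp.trans hp)
  rw [oplus_comm] at hu
  have hux : u ≤ x := left_le_left_of_oplus hu hs le_sup_right le_rfl
  obtain ⟨k, hk⟩ := (le_iff_exists_oplus u x).1 hux
  exact compatible_of_oplus hk hu hs

theorem compatible_of_le (h : x ≤ y) : Compatible x y := by
  obtain ⟨p, hp⟩ := (le_iff_exists_oplus x y).1 h
  exact compatible_of_le_oplus hp (right_le_of_oplus hp) le_rfl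

theorem Compatible.exists_oplus (h : Compatible x y) :
    ∃ p q, oplus (x ⊓ y) p = some x ∧ oplus (x ⊓ y) q = some y ∧ oplus x q = some (x ⊔ y) ∧
      oplus y p = some (x ⊔ y) := by
  obtain ⟨q, hq, hxq⟩ := h
  obtain ⟨p, hp⟩ := (le_iff_exists_oplus (x ⊓ y) x).1 inf_le_left
  exact ⟨p, q, hp, hq, hxq, oplus_right_comm hp hxq hq⟩

theorem Compatible.symm (h : Compatible x y) : Compatible y x := by
  obtain ⟨p, q, hp, hq, -, hyp⟩ := h.exists_oplus
  exact compatible_of_oplus hq hp hyp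

theorem compatible_of_le_compl (h : x ≤ compl y) : Compatible x y := by
  obtain ⟨v, hv⟩ := exists_oplus_of_le_compl (le_compl_comm.1 h)
  exact compatible_of_oplus (zero_oplus x) (zero_oplus y) hv

theorem Compatible.compl_right (h : Compatible x y) : Compatible x (compl y) := by
  obtain ⟨p, q, hp, -, -, hyp⟩ := h.exists_oplus
  obtain ⟨r, hr, hr'⟩ := exists_oplus_assoc hyp (oplus_compl (x ⊔ y))
  obtain rfl := eq_compl hr'
  obtain ⟨e, he, -⟩ := exists_oplus_of_le_left (oplus_compl (x ⊔ y)) (le_sup_left : x ≤ x ⊔ y)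
  rw [oplus_comm] at hp
  exact compatible_of_oplus hp hr he

theorem compatible_of_isLUB {S : Set E} (hS : IsLUB S y) (h : ∀ z ∈ S, Compatible x z) :
    Compatible x y := by
  obtain ⟨v, hv⟩ := exists_oplus_of_le_compl (inf_le_left : compl x ⊓ y ≤ compl x)
  refine compatible_of_le_oplus hv inf_le_right (hS.2 fun z hz => ?_)
  obtain ⟨e, he, hxe⟩ := h z hz
  obtain ⟨f, hf, hfv⟩ := exists_oplus_of_le_right hv
    (le_inf (le_compl_of_oplus hxe) ((right_le_of_oplus he).trans (hS.1 hz)))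
  obtain rfl := Option.some.inj (hxe.symm.trans hf)
  exact le_sup_right.trans hfv

theorem Compatible.sup_right (hy : Compatible x y) (hz : Compatible x z) :
    Compatible x (y ⊔ z) :=
  compatible_of_isLUB isLUB_pair (by rintro w (rfl | rfl) <;> assumption)

theorem Compatible.inf_right (hy : Compatible x y) (hz : Compatible x z) :
    Compatible x (y ⊓ z) := by
  have := (hy.compl_right.sup_right hz.compl_right).compl_right
  rwa [← compl_inf, compl_compl_eq] at this

theorem Compatible.of_oplus_of_le (hg : Compatible x g) (h : oplus g w = some y) (hxy : x ≤ y) :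
    Compatible x w := by
  obtain ⟨p, q, hp, -, -, hgp⟩ := hg.exists_oplus
  obtain ⟨t, ht⟩ := (le_iff_exists_oplus (x ⊔ g) y).1 (sup_le hxy (left_le_of_oplus h))
  obtain ⟨r, hr, hr'⟩ := exists_oplus_assoc hgp ht
  obtain rfl := oplus_left_cancel h hr'
  obtain ⟨e, he, -⟩ := exists_oplus_of_le_left ht (le_sup_left : x ≤ x ⊔ g)
  rw [oplus_comm] at hp
  exact compatible_of_oplus hp hr he

/-- The elements compatible with `x` are closed under differences. -/
theorem Compatible.of_oplus (hg : Compatible x g) (hy : Compatible x y)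
    (h : oplus g w = some y) : Compatible x w := by
  have hgy : Compatible (x ⊓ y) g :=
    (hg.symm.inf_right (compatible_of_le (left_le_of_oplus h))).symm
  have hw : Compatible (x ⊓ y) w := hgy.of_oplus_of_le h inf_le_right
  obtain ⟨p, -, hp, -, -, hyp⟩ := hy.exists_oplus
  obtain ⟨α, γ, hα, hγ, hsup, -⟩ := hw.exists_oplus
  obtain ⟨e, he, -⟩ := exists_oplus_of_le_left hyp
    (sup_le inf_le_right (right_le_of_oplus h) : (x ⊓ y) ⊔ w ≤ y)
  have hxγ : oplus x γ = some e := oplus_right_comm hsup he hp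
  obtain ⟨k, -, hk⟩ := exists_oplus_assoc hα hp
  exact compatible_of_oplus hk hγ hxγ

theorem Compatible.oplus_right (hy : Compatible x y) (hz : Compatible x z)
    (h : oplus y z = some w) : Compatible x w := by
  obtain ⟨r, hr, hr'⟩ := exists_oplus_assoc h (oplus_compl w)
  obtain rfl := eq_compl hr'
  have := (hz.of_oplus hy.compl_right hr).compl_right
  rwa [compl_compl_eq] at this

theorem Compatible.multiple_right (h : Compatible x a) {n : ℕ} (hn : multiple a n = some c) :
    Compatible x c := by
  induction n generalizing c with
  | zero =>
    obtain rfl : (0 : E) = c := Option.some.inj hn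
    exact (compatible_of_le (bot_le : (⊥ : E) ≤ x)).symm
  | succ n ih =>
    obtain ⟨s, hs, hsa⟩ := Option.bind_eq_some_iff.1 hn
    exact (ih hs).oplus_right h hsa

theorem Compatible.oplus_eq_sup (h : Compatible x y) (h0 : x ⊓ y = 0) :
    oplus x y = some (x ⊔ y) := by
  obtain ⟨q, hq, hxq⟩ := h
  rw [h0, zero_oplus] at hq
  rwa [Option.some.inj hq] at hxq

theorem inf_eq_zero_of_isAtom (hb : IsAtom b) (h : ¬ b ≤ x) : x ⊓ b = 0 :=
  (inf_comm x b).trans ((hb.le_iff.1 inf_le_left).resolve_right fun h' => h (h' ▸ inf_le_right))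

theorem Compatible.le_or_le_compl_of_isAtom (h : Compatible x b) (hb : IsAtom b) :
    b ≤ x ∨ x ≤ compl b := by
  refine or_iff_not_imp_left.2 fun hbx => ?_
  rw [le_compl_comm]
  exact le_compl_of_oplus (h.oplus_eq_sup (inf_eq_zero_of_isAtom hb hbx))

/-! ### Multiples of atoms -/

theorem exists_multiple_eq_none (hArch : IsArchimedean E) (hb : b ≠ 0) :
    ∃ n, (∃ c, multiple b n = some c) ∧ multiple b (n + 1) = none := by
  have := hArch b hb
  simp only [HasInfiniteOrder, not_forall, not_not] at this
  obtain ⟨m, -, hm⟩ := this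
  by_contra! h
  have : ∀ n, ∃ c, multiple b n = some c := by
    intro n
    induction n with
    | zero => exact ⟨0, rfl⟩
    | succ n ih => exact Option.ne_none_iff_exists'.1 (h n ih)
  obtain ⟨c, hc⟩ := this m
  rw [hm] at hc
  cases hc

/-- If some multiple of `b` is not defined or not below `z`, there is a last one below `z`
before it. -/
theorem exists_last_multiple_le {k : ℕ} (hk : ¬ ∃ c, multiple b k = some c ∧ c ≤ z) :
    ∃ j < k, (∃ c, multiple b j = some c ∧ c ≤ z) ∧
      ¬ ∃ c, multiple b (j + 1) = some c ∧ c ≤ z := by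
  induction k with
  | zero => exact absurd ⟨0, rfl, (bot_le : (⊥ : E) ≤ z)⟩ hk
  | succ k ih =>
    by_cases h : ∃ c, multiple b k = some c ∧ c ≤ z
    · exact ⟨k, k.lt_succ_self, h, hk⟩
    · obtain ⟨j, hj, h⟩ := ih h
      exact ⟨j, hj.trans k.lt_succ_self, h⟩

/-- If `b ≠ 0` lies below `x ⊖ (x ⊓ y)`, then some multiple of `b` lies below `x` but not
below `y`. -/
theorem exists_multiple_le_not_le (hArch : IsArchimedean E) (hb : b ≠ 0)
    (hw : oplus (x ⊓ y) w = some x) (hbw : b ≤ w) :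
    ∃ k c, multiple b k = some c ∧ c ≤ x ∧ ¬ c ≤ y := by
  obtain ⟨n, -, hn⟩ := exists_multiple_eq_none hArch hb
  obtain ⟨k, -, ⟨c, hc, hcx⟩, hk⟩ := exists_last_multiple_le (b := b) (z := x) (k := n + 1)
    (by rw [hn]; rintro ⟨c, hc, -⟩; cases hc)
  refine ⟨k, c, hc, hcx, fun hcy => hk ?_⟩
  obtain ⟨e, he, hex⟩ := exists_oplus_of_le_right hw hbw
  obtain ⟨f, hf, hfe⟩ := exists_oplus_of_le_left he (le_inf hcx hcy)
  exact ⟨f, by rw [multiple, hc]; exact hf, hfe.trans hex⟩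

theorem exists_oplus_inf_of_not_le (h : ¬ x ≤ y) : ∃ w, oplus (x ⊓ y) w = some x ∧ w ≠ 0 := by
  obtain ⟨w, hw⟩ := (le_iff_exists_oplus (x ⊓ y) x).1 inf_le_left
  refine ⟨w, hw, fun h0 => h ?_⟩
  rw [h0, oplus_zero] at hw
  exact inf_eq_left.1 (Option.some.inj hw)

theorem isLUB_multiples_of_atoms (hArch : IsArchimedean E) (hAtomic : IsAtomic E) (x : E) :
    IsLUB {c | c ≤ x ∧ ∃ b k, IsAtom b ∧ b ≤ x ∧ multiple b k = some c} x := by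
  refine ⟨fun c hc => hc.1, fun y hy => ?_⟩
  by_contra hxy
  obtain ⟨w, hw, hw0⟩ := exists_oplus_inf_of_not_le hxy
  obtain ⟨b, hb, hbw⟩ := (hAtomic.eq_bot_or_exists_atom_le w).resolve_left hw0
  obtain ⟨k, c, hc, hcx, hcy⟩ := exists_multiple_le_not_le hArch hb.1 hw hbw
  exact hcy (hy ⟨hcx, b, k, hb, hbw.trans (right_le_of_oplus hw), hc⟩)

/-- If `t ∧ b = 0`, then `t` is orthogonal to all multiples of `b`: from `mb ⊥ t` and `mb ⊥ b`
follows `mb ⊥ t ⊔ b = t ⊕ b`. -/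
theorem Compatible.exists_oplus_multiple (h : Compatible t b) (h0 : t ⊓ b = 0) {n : ℕ}
    (hn : multiple b n = some c) : ∃ e, oplus t c = some e := by
  induction n generalizing c with
  | zero =>
    obtain rfl : (0 : E) = c := Option.some.inj hn
    exact ⟨t, oplus_zero t⟩
  | succ n ih =>
    obtain ⟨s, hs, hsb⟩ := Option.bind_eq_some_iff.1 hn
    obtain ⟨e, he⟩ := ih hs
    rw [oplus_comm] at he
    obtain ⟨f, hf⟩ := exists_oplus_of_le_compl
      (sup_le (le_compl_of_oplus he) (le_compl_of_oplus hsb))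
    rw [oplus_comm] at hf
    obtain ⟨m, hm, hm'⟩ := exists_oplus_assoc (h.oplus_eq_sup h0) hf
    rw [oplus_comm] at hm
    obtain rfl := Option.some.inj (hm.symm.trans hsb)
    exact ⟨f, hm'⟩

/-! ### Blocks -/

theorem exists_isBlock_superset {S : Set E} (hS : ∀ x ∈ S, ∀ y ∈ S, Compatible x y) :
    ∃ M, S ⊆ M ∧ IsBlock M := by
  refine zorn_subset_nonempty {S : Set E | ∀ x ∈ S, ∀ y ∈ S, Compatible x y} ?_ S hS
  intro C hC hchain hne
  refine ⟨⋃₀ C, ?_, fun s hs => Set.subset_sUnion_of_mem hs⟩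
  rintro x ⟨s, hs, hx⟩ y ⟨t, ht, hy⟩
  obtain h | h := hchain.total hs ht
  · exact hC ht x (h hx) y hy
  · exact hC hs x hx y (h hy)

theorem compatible_insert {S : Set E} (hS : ∀ x ∈ S, ∀ y ∈ S, Compatible x y)
    (h : ∀ y ∈ S, Compatible z y) : ∀ x ∈ insert z S, ∀ y ∈ insert z S, Compatible x y := by
  rintro x (rfl | hx) y (rfl | hy)
  · exact compatible_of_le le_rfl
  · exact h y hy
  · exact (h x hx).symm
  · exact hS x hx y hy

namespace IsBlock

variable {M : Set E}

theorem compatible (hM : IsBlock M) (hx : x ∈ M) (hy : y ∈ M) : Compatible x y :=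
  hM.prop x hx y hy

theorem mem_of_forall_compatible (hM : IsBlock M) (h : ∀ y ∈ M, Compatible z y) : z ∈ M :=
  hM.le_of_ge (compatible_insert hM.prop h) (Set.subset_insert z M) (Set.mem_insert z M)

theorem inf_mem (hM : IsBlock M) (hx : x ∈ M) (hy : y ∈ M) : x ⊓ y ∈ M :=
  hM.mem_of_forall_compatible fun _ hm =>
    ((hM.compatible hm hx).inf_right (hM.compatible hm hy)).symm

theorem sub_mem (hM : IsBlock M) (hx : x ∈ M) (hy : y ∈ M) (h : oplus x w = some y) : w ∈ M :=
  hM.mem_of_forall_compatible fun _ hm =>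
    ((hM.compatible hm hx).of_oplus (hM.compatible hm hy) h).symm

theorem multiple_mem (hM : IsBlock M) (hx : x ∈ M) {n : ℕ} (h : multiple x n = some c) : c ∈ M :=
  hM.mem_of_forall_compatible fun _ hm => ((hM.compatible hm hx).multiple_right h).symm

/-- A block of a block-finite lattice effect algebra is the commutant of a finite subset. -/
theorem exists_finite_commutant (hM : IsBlock M) (hfin : IsBlockFinite E) :
    ∃ D : Set E, D.Finite ∧ D ⊆ M ∧ ∀ z, (∀ d ∈ D, Compatible z d) → z ∈ M := by
  -- `D` contains an element of `M \ N` for each block `N ≠ M`.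
  have h : ∀ N : Set E, ∃ d ∈ M, IsBlock N → N ≠ M → d ∉ N := by
    intro N
    by_cases hMN : M ⊆ N
    · have h0 : (0 : E) ∈ M :=
        hM.mem_of_forall_compatible fun _ _ => compatible_of_le bot_le
      exact ⟨0, h0, fun hN hne => absurd ((hM.eq_of_le hN.prop hMN).symm) hne⟩
    · obtain ⟨d, hd, hd'⟩ := Set.not_subset.1 hMN
      exact ⟨d, hd, fun _ _ => hd'⟩
  choose f hfM hf using h
  have hDM : f '' {N | IsBlock N} ⊆ M := by rintro _ ⟨N, -, rfl⟩; exact hfM N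
  refine ⟨f '' {N | IsBlock N}, hfin.image f, hDM, fun z hz => ?_⟩
  obtain ⟨N, hsub, hN⟩ := exists_isBlock_superset
    (compatible_insert (fun x hx y hy => hM.compatible (hDM hx) (hDM hy)) hz)
  have hNM : N = M := by
    by_contra hne
    exact hf N hN hne (hsub (Or.inr ⟨N, hN, rfl⟩))
  exact hNM ▸ hsub (Or.inl rfl)

/-- Every element of a block `M` is a finite orthogonal sum of elements `c` with `[0, c] ⊆ M`. -/
theorem induction (hM : IsBlock M) (hfin : IsBlockFinite E) {Q : E → Prop}
    (hQ : ∀ c, (∀ e ≤ c, e ∈ M) → Q c)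
    (hadd : ∀ a b c, oplus a b = some c → Q a → Q b → Q c) (hx : x ∈ M) : Q x := by
  obtain ⟨D, hD, hDM, hcomm⟩ := hM.exists_finite_commutant hfin
  have key : ∀ S : Set E, S.Finite → S ⊆ M →
      (∀ c ∈ M, (∀ d ∈ S, c ≤ d ∨ c ≤ compl d) → Q c) → ∀ c ∈ M, Q c := by
    intro S hS
    induction S, hS using Set.Finite.induction_on with
    | empty => exact fun _ h c hc => h c hc fun d hd => hd.elim
    | @insert d S _ _ ih =>
      intro hSM h
      refine ih ((Set.subset_insert d S).trans hSM) fun c hc hcS => ?_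
      have hd : d ∈ M := hSM (Set.mem_insert d S)
      -- Split `c` into `c ⊓ d ≤ d` and `r = c ⊖ (c ⊓ d) ≤ d'`.
      obtain ⟨r, -, hr, -, -, hdr⟩ := (hM.compatible hc hd).exists_oplus
      have hcd := hM.inf_mem hc hd
      refine hadd _ _ _ hr (h _ hcd ?_) (h r (hM.sub_mem hcd hc hr) ?_)
      · rintro e (rfl | he)
        · exact Or.inl inf_le_right
        · exact (hcS e he).imp inf_le_left.trans inf_le_left.trans
      · rintro e (rfl | he)
        · exact Or.inr (le_compl_of_oplus hdr)
        · exact (hcS e he).imp (right_le_of_oplus hr).trans (right_le_of_oplus hr).trans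
  refine key D hD hDM (fun c _ hc => hQ c fun e hec => hcomm e fun d hd => ?_) x hx
  obtain h | h := hc d hd
  · exact compatible_of_le (hec.trans h)
  · exact compatible_of_le_compl (hec.trans h)

theorem exists_isAtom_le (hM : IsBlock M) (hfin : IsBlockFinite E) (hAtomic : IsAtomic E)
    (hx : x ∈ M) (h0 : x ≠ 0) : ∃ b ∈ M, IsAtom b ∧ b ≤ x := by
  have : x = 0 ∨ ∃ b ∈ M, IsAtom b ∧ b ≤ x := by
    refine hM.induction hfin (Q := fun x => x = 0 ∨ ∃ b ∈ M, IsAtom b ∧ b ≤ x) ?_ ?_ hx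
    · intro c hc
      exact (hAtomic.eq_bot_or_exists_atom_le c).imp id fun ⟨b, hb, hbc⟩ => ⟨b, hc b hbc, hb, hbc⟩
    · rintro a b c h (rfl | ⟨e, he, hea, hle⟩) hb
      · rw [zero_oplus] at h
        rwa [← Option.some.inj h]
      · exact Or.inr ⟨e, he, hea, hle.trans (left_le_of_oplus h)⟩
  exact this.resolve_left h0

theorem mem_of_compatible_atoms (hM : IsBlock M) (hfin : IsBlockFinite E)
    (hArch : IsArchimedean E) (hAtomic : IsAtomic E)
    (h : ∀ b ∈ M, IsAtom b → Compatible x b) : x ∈ M := by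
  refine hM.mem_of_forall_compatible fun m hm => ?_
  refine hM.induction hfin (Q := Compatible x) (fun c hc => ?_)
    (fun a b c hc ha hb => ha.oplus_right hb hc) hm
  refine compatible_of_isLUB (isLUB_multiples_of_atoms hArch hAtomic c) ?_
  rintro e ⟨-, b, k, hb, hbc, hk⟩
  exact (h b (hc b hbc) hb).multiple_right hk

theorem exists_cover_of_notMem (hM : IsBlock M) (hfin : IsBlockFinite E)
    (hArch : IsArchimedean E) (hAtomic : IsAtomic E) (hx : x ∉ M) :
    ∃ c d : E, (∀ z ∈ M, c ≤ z ∨ z ≤ d) ∧ ¬ c ≤ x ∧ ¬ x ≤ d := by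
  obtain ⟨b, hbM, hb, hxb⟩ : ∃ b ∈ M, IsAtom b ∧ ¬ Compatible x b := by
    by_contra! h
    exact hx (hM.mem_of_compatible_atoms hfin hArch hAtomic h)
  exact ⟨b, compl b, fun z hz => (hM.compatible hz hbM).le_or_le_compl_of_isAtom hb,
    fun h => hxb (compatible_of_le h).symm, fun h => hxb (compatible_of_le_compl h)⟩

theorem exists_cover_of_not_le (hM : IsBlock M) (hfin : IsBlockFinite E)
    (hArch : IsArchimedean E) (hAtomic : IsAtomic E) (hx : x ∈ M) (hy : y ∈ M) (hxy : ¬ x ≤ y) :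
    ∃ c d : E, (∀ z ∈ M, c ≤ z ∨ z ≤ d) ∧ ¬ c ≤ y ∧ ¬ x ≤ d := by
  obtain ⟨w, hw, hw0⟩ := exists_oplus_inf_of_not_le hxy
  obtain ⟨b, hbM, hb, hbw⟩ := hM.exists_isAtom_le hfin hAtomic
    (hM.sub_mem (hM.inf_mem hx hy) hx hw) hw0
  obtain ⟨k, c, hc, hcx, hcy⟩ := exists_multiple_le_not_le hArch hb.1 hw hbw
  obtain ⟨n, ⟨e, he⟩, hn⟩ := exists_multiple_eq_none hArch hb.1
  have hk0 : k ≠ 0 := by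
    rintro rfl
    obtain rfl : (0 : E) = c := Option.some.inj hc
    exact hcy (bot_le : (⊥ : E) ≤ y)
  have hkn : k ≤ n := by
    by_contra! hlt
    obtain ⟨m, rfl⟩ := Nat.exists_eq_add_of_le (Nat.succ_le_of_lt hlt)
    obtain ⟨s, t, hs, -⟩ := exists_multiple_of_add hc
    rw [hn] at hs
    cases hs
  obtain ⟨r, f, -, hf, -⟩ := exists_multiple_of_add (m := k - 1) (n := n + 1 - k)
    (by rwa [show k - 1 + (n + 1 - k) = n by lia])
  refine ⟨c, compl f, fun z hz => or_iff_not_imp_left.2 fun hcz => ?_, hcy, fun hxf => ?_⟩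
  · obtain ⟨j, hjk, ⟨s, hs, hsz⟩, hj⟩ := exists_last_multiple_le (b := b) (z := z) (k := k)
      (by rintro ⟨c', hc', hle⟩; exact hcz (Option.some.inj (hc.symm.trans hc') ▸ hle))
    obtain ⟨t, ht⟩ := (le_iff_exists_oplus s z).1 hsz
    have htM : t ∈ M := hM.sub_mem (hM.multiple_mem hbM hs) hz ht
    have hbt : ¬ b ≤ t := by
      intro hbt
      obtain ⟨m, hm, hmz⟩ := exists_oplus_of_le_right ht hbt
      exact hj ⟨m, by rw [multiple, hs]; exact hm, hmz⟩
    -- As `t = z ⊖ jb` is disjoint from `b`, the sum `t ⊕ nb` exists; but `nb ≥ jb ⊕ f`.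
    obtain ⟨l, hl⟩ := (hM.compatible htM hbM).exists_oplus_multiple
      (inf_eq_zero_of_isAtom hb hbt) he
    obtain ⟨i, hi⟩ := Nat.exists_eq_add_of_le (show j + (n + 1 - k) ≤ n by lia)
    rw [hi] at he
    obtain ⟨g, h', hg, -, hgh⟩ := exists_multiple_of_add he
    rw [multiple_add_eq_some hs hf] at hg
    obtain ⟨l', hl', -⟩ := exists_oplus_of_le_right hl (left_le_of_oplus hgh)
    obtain ⟨z', hz', hz''⟩ := exists_oplus_assoc' hg hl'
    rw [oplus_comm] at hz'
    obtain rfl := Option.some.inj (ht.symm.trans hz')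
    rw [oplus_comm] at hz''
    exact le_compl_of_oplus hz''
  · obtain ⟨m, hm⟩ := exists_oplus_of_le_compl (hcx.trans hxf)
    rw [oplus_comm, ← multiple_add_eq_some hc hf, show k + (n + 1 - k) = n + 1 by lia, hn] at hm
    cases hm

/-- A block is covered by two intervals `[c, 1]` and `[0, d]` that do not contain both of two
given points. -/
theorem exists_cover (hM : IsBlock M) (hfin : IsBlockFinite E)
    (hArch : IsArchimedean E) (hAtomic : IsAtomic E) (hxy : x ≠ y) :
    ∃ p : E × E, (∀ z ∈ M, p.1 ≤ z ∨ z ≤ p.2) ∧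
      ¬ (p.1 ≤ x ∧ p.1 ≤ y) ∧ ¬ (x ≤ p.2 ∧ y ≤ p.2) := by
  by_cases hx : x ∈ M
  · by_cases hy : y ∈ M
    · by_cases hle : x ≤ y
      · have hle' : ¬ y ≤ x := fun h => hxy (le_antisymm hle h)
        obtain ⟨c, d, h, hc, hd⟩ := hM.exists_cover_of_not_le hfin hArch hAtomic hy hx hle'
        exact ⟨(c, d), h, fun h => hc h.1, fun h => hd h.2⟩
      · obtain ⟨c, d, h, hc, hd⟩ := hM.exists_cover_of_not_le hfin hArch hAtomic hx hy hle
        exact ⟨(c, d), h, fun h => hc h.2, fun h => hd h.1⟩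
    · obtain ⟨c, d, h, hc, hd⟩ := hM.exists_cover_of_notMem hfin hArch hAtomic hy
      exact ⟨(c, d), h, fun h => hc h.2, fun h => hd h.2⟩
  · obtain ⟨c, d, h, hc, hd⟩ := hM.exists_cover_of_notMem hfin hArch hAtomic hx
    exact ⟨(c, d), h, fun h => hc h.1, fun h => hd h.1⟩

end IsBlock

end LatticeEffectAlgebra

open LatticeEffectAlgebra in
theorem t2Space_intervalTopology_of_isBlockFinite (E : Type u) [LatticeEffectAlgebra E]
    (hArch : EffectAlgebra.IsArchimedean E) (hAtomic : IsAtomic E) (hfin : IsBlockFinite E) :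
    @T2Space E (intervalTopology E) := by
  refine t2Space_intervalTopology_of_finite_cover fun x y hxy => ?_
  have h : ∀ M : Set E, ∃ p : E × E, IsBlock M → (∀ z ∈ M, p.1 ≤ z ∨ z ≤ p.2) ∧
      ¬ (p.1 ≤ x ∧ p.1 ≤ y) ∧ ¬ (x ≤ p.2 ∧ y ≤ p.2) := by
    intro M
    by_cases hM : IsBlock M
    · exact (hM.exists_cover hfin hArch hAtomic hxy).imp fun p hp _ => hp
    · exact ⟨(x, y), fun h => absurd h hM⟩
  choose f hf using h
  refine ⟨f '' {M | IsBlock M}, hfin.image f, fun z => ?_, ?_⟩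
  · obtain ⟨M, hzM, hM⟩ := exists_isBlock_superset (S := {z})
      (by rintro x rfl y rfl; exact compatible_of_le le_rfl)
    exact ⟨f M, ⟨M, hM, rfl⟩, (hf M hM).1 z (hzM rfl)⟩
  · rintro _ ⟨M, hM, rfl⟩
    exact (hf M hM).2

theorem mainTheorem5 (E : Type u) [LatticeEffectAlgebra E]
    (hArch : EffectAlgebra.IsArchimedean E) (hAtomic : IsAtomic E)
    (hBlock : LatticeEffectAlgebra.IsBlockFinite E) :
    @T2Space E (intervalTopology E) ∧ intervalTopology E = netOrderTopology E := by
  have hT2 := t2Space_intervalTopology_of_isBlockFinite E hArch hAtomic hBlock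
  exact ⟨hT2, intervalTopology_eq_netOrderTopology E hT2⟩
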